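/- Let $F(x)=4x(1-x)$ on $[0,1]$, and partition $[0,1]$ into four equal subintervals $A=[0,1/4)$, $B=[1/4,1/2)$, $C=[1/2,3/4]$, $D=(3/4,1]$. For $x\in[0,1]$ let $\mathcal S(x)=(s_0,s_1,\dots)$, $s_n\in\{A,B,C,D\}$, be its symbolic sequence, i.e. $F^n(x)$ lies in the interval $s_n$. A block ${\bf s}$ of $m$ consecutive symbols is admissible for a sequence if it occurs in that sequence, and forbidden otherwise; it is admissible for the map if it occurs in $\mathcal S(x)$ for some $x\in[0,1]$, and otherwise forbidden for the map. Let $\mu$ be the measure on $(0,1)$ with density $1/(\pi\sqrt{x(1-x)})$, and let $P({\bf s})$ be the $\mu$-measure of the set of $x\in[0,1]$ for which $\mathcal S(x)$ begins with ${\bf s}$. For a set $\mathcal A(m)$ of blocks of size $m$ and $\beta\ge 0$ put $$H_m(\beta)=\frac1{1-\beta}\log\sum_{{\bf s}\in\mathcal A(m)}P({\bf s})^\beta\quad(\beta\ne1),\qquad H_m(1)=-\sum_{{\bf s}\in\mathcal A(m)}P({\bf s})\log P({\bf s}),$$ where $p^0=1$ for every $p \ge 0$ (so that $H_m(0)=\log|\mathcal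 A(m)|$) and $0\log 0=0$. Then: 1. $\mu$ is a probability measure and is invariant under $F$. 2. If $\mathcal A(m)$ is the set of blocks of size $m$ that are admissible for the map, then $\lim_{m\to\infty}H_m(\beta)/m=\log 2$ for every $\beta\ge0$. 3. For Lebesgue-almost every $x\in[0,1]$, the symbolic sequence $\mathcal S(x)$ has the following properties. Every block ${\bf s}$ occurs in it with limiting frequency $P({\bf s})$. If $\mathcal A(m)$ is the set of blocks of size $m$ that are admissible for $\mathcal S(x)$, then $\lim_{m\to\infty}H_m(\beta)/m=\log2$ for every $\beta\ge0$. For every $m\ge1$ exactly $2^{m+1}$ blocks of size $m$ are admissible and exactly $2^m(2^m-2)$ are forbidden for $\mathcal S(x)$ (in particular there are $8$ forbidden blocks of size $2$). 4. $\log 2<\log 4$, and forbidden patterns exist for the map: the block $(A,D)$ is forbidden for the map, i.e. for every $x\in[0,1]$ the symbol $A$ is never immediately followed by $D$ in $\mathcal S(x)$. -/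

import Mathlib

open Filter Topology MeasureTheory

namespace FourSymbolLogistic

/-- The fully chaotic logistic map `x ↦ 4 x (1 - x)`. -/
def logisticMap (x : ℝ) : ℝ := 4 * x * (1 - x)

/-- The four symbols of the homogeneous partition of `[0,1]`. -/
inductive QuarterSymbol : Type
  | A | B | C | D
  deriving DecidableEq

instance : Fintype QuarterSymbol where
  elems := {.A, .B, .C, .D}
  complete := by intro x; cases x <;> simp

/-- The symbol of a point of `[0,1]` for the partition
`A = [0,1/4)`, `B = [1/4,1/2)`, `C = [1/2,3/4]`, `D = (3/4,1]`. -/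
noncomputable def quarterSymbol (x : ℝ) : QuarterSymbol :=
  if x < 1 / 4 then .A else if x < 1 / 2 then .B else if x ≤ 3 / 4 then .C else .D

/-- The symbolic sequence `(s₀, s₁, …)` of the trajectory `x, F x, F² x, …`. -/
noncomputable def symbolSeq (x : ℝ) (n : ℕ) : QuarterSymbol :=
  quarterSymbol (logisticMap^[n] x)

/-- The block of `m` consecutive symbols of `s` that starts at position `n`. -/
def blockAt {α : Type*} (s : ℕ → α) (m n : ℕ) : Fin m → α := fun i => s (n + i)

/-- The blocks of size `m` that are present in the sequence `s`. -/
def admissibleBlocks {α : Type*} (s : ℕ → α) (m : ℕ) : Set (Fin m → α) :=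
  Set.range (blockAt s m)

/-- The blocks of size `m` that are never seen in the sequence `s`. -/
def forbiddenBlocks {α : Type*} (s : ℕ → α) (m : ℕ) : Set (Fin m → α) :=
  (admissibleBlocks s m)ᶜ

/-- The proportion of the first `N` positions of `s` at which the block `w` starts. -/
noncomputable def blockFrequency {α : Type*} [DecidableEq α] (s : ℕ → α) {m : ℕ}
    (w : Fin m → α) (N : ℕ) : ℝ :=
  (((Finset.range N).filter fun n => blockAt s m n = w).card : ℝ) / N

/-- The blocks of size `m` that are present in the symbolic sequence of some trajectory
in `[0,1]`. -/
def mapAdmissibleBlocks (m : ℕ) : Set (Fin m → QuarterSymbol) :=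
  ⋃ x ∈ Set.Icc (0 : ℝ) 1, admissibleBlocks (symbolSeq x) m

/-- The blocks of size `m` that no trajectory in `[0,1]` ever shows. -/
def mapForbiddenBlocks (m : ℕ) : Set (Fin m → QuarterSymbol) :=
  (mapAdmissibleBlocks m)ᶜ

/-- The natural invariant measure of the logistic map, with density `1 / (π √(x (1 - x)))` on
`(0,1)`. -/
noncomputable def naturalMeasure : Measure ℝ :=
  (volume.restrict (Set.Ioo (0 : ℝ) 1)).withDensity
    fun x => ENNReal.ofReal (1 / (Real.pi * Real.sqrt (x * (1 - x))))

/-- The points of `[0,1]` whose symbolic sequence begins with the block `w`. -/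
def cylinder {m : ℕ} (w : Fin m → QuarterSymbol) : Set ℝ :=
  {x | x ∈ Set.Icc (0 : ℝ) 1 ∧ blockAt (symbolSeq x) m 0 = w}

/-- The probability of the block `w` under the natural invariant measure. -/
noncomputable def blockProb {m : ℕ} (w : Fin m → QuarterSymbol) : ℝ :=
  naturalMeasure.real (cylinder w)

/-- The Rényi block entropy `H(β)` of a set `S` of admissible blocks of size `m` with
probabilities `P`: the Shannon entropy `-∑ P log P` for `β = 1`, and
`(1 - β)⁻¹ log ∑ P ^ β` otherwise, the sums running over `S`.
As `p ^ 0 = 1` for every real `p`, the value at `β = 0` is `log |S|`. -/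
noncomputable def renyiBlockEntropy {α : Type*} [Fintype α] {m : ℕ} (S : Set (Fin m → α))
    (P : (Fin m → α) → ℝ) (β : ℝ) : ℝ :=
  if β = 1 then -∑ w ∈ S.toFinite.toFinset, P w * Real.log (P w)
  else 1 / (1 - β) * Real.log (∑ w ∈ S.toFinite.toFinset, P w ^ β)

end FourSymbolLogistic

/-!
The map `θ ↦ sin² (π θ)` on the circle carries Haar measure to the natural measure and
semiconjugates angle doubling to the logistic map (`measurePreserving_circleMap`,
`semiconj_circleMap`). Hence the natural measure is an invariant ergodic probability measure. It is
also symmetric under `x ↦ 1 - x`, which interchanges the two monotone branches, so that each branch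
carries half of it: `μ (F⁻¹ s ∩ branch) = μ s / 2` (`two_mul_measure_preimage_inter_branch`).

Apart from the preimages of the fixed point `3 / 4`, the partition is Markov: `A` and `D` are
followed by `A`, `B` or `C`, whereas `B` and `C` are followed by `D`. Thus each symbol has exactly
two predecessors, one in each branch, and prolonging a block to the left by one of them halves its
probability (`blockProb_vecCons_predSymbol`). Therefore the number of blocks of positive probability
doubles with the size (`ncard_typicalBlocks`) and their probabilities are of the order `2 ^ (-m)`
(`blockProb_mem_Icc`). The further blocks that the map admits, all of probability zero, end in a
string of `C`s produced by the fixed point; they do not change the order `2 ^ m` of the number of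
blocks (`ncard_mapAdmissibleBlocks_le`). These estimates alone force all Rényi entropy rates to be
`log 2` (`tendsto_renyiBlockEntropy_div`).

For almost every orbit, the pointwise ergodic theorem (`ae_tendsto_birkhoffAverage`), proved here by
Garsia's maximal argument for ergodic maps, gives the block frequencies. Consequently such an orbit
shows exactly the blocks of positive probability (`ae_admissibleBlocks_eq`).
-/

namespace FourSymbolLogistic

/-! ### The pointwise ergodic theorem -/

section Ergodic

variable {Ω : Type*} {T : Ω → Ω} {f : Ω → ℝ}

/-- The maximum of the Birkhoff sums of `f` over the times `0, …, n`, defined through the recursion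
`M (n + 1) = max 0 (f + M n ∘ T)`. -/
def maxBirkhoffSum (T : Ω → Ω) (f : Ω → ℝ) : ℕ → Ω → ℝ
  | 0, _ => 0
  | n + 1, x => max 0 (f x + maxBirkhoffSum T f n (T x))

lemma maxBirkhoffSum_nonneg (n : ℕ) (x : Ω) : 0 ≤ maxBirkhoffSum T f n x := by
  cases n with
  | zero => exact le_rfl
  | succ n => exact le_max_left _ _

lemma monotone_maxBirkhoffSum (x : Ω) : Monotone fun n => maxBirkhoffSum T f n x := by
  refine monotone_nat_of_le_succ fun n => ?_
  induction n generalizing x with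
  | zero => exact le_max_left _ _
  | succ n ih =>
    have := ih (T x)
    simp only [maxBirkhoffSum] at this ⊢
    gcongr

lemma birkhoffSum_le_maxBirkhoffSum (n : ℕ) (x : Ω) :
    birkhoffSum T f n x ≤ maxBirkhoffSum T f n x := by
  induction n generalizing x with
  | zero => simp [maxBirkhoffSum]
  | succ n ih =>
    rw [birkhoffSum_succ', maxBirkhoffSum]
    exact le_max_of_le_right (by gcongr; exact ih _)

lemma maxBirkhoffSum_succ_sub (n : ℕ) (x : Ω) :
    maxBirkhoffSum T f (n + 1) x - maxBirkhoffSum T f n (T x) =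
      max (-maxBirkhoffSum T f n (T x)) (f x) := by
  rw [maxBirkhoffSum, max_sub_sub_right _ _ _ |>.symm]
  simp

variable [MeasurableSpace Ω] {ν : Measure Ω}

lemma measurable_maxBirkhoffSum (hT : Measurable T) (hf : Measurable f) (n : ℕ) :
    Measurable (maxBirkhoffSum T f n) := by
  induction n with
  | zero => exact measurable_const
  | succ n ih => exact measurable_const.max (hf.add (ih.comp hT))

lemma integrable_maxBirkhoffSum [IsFiniteMeasure ν] (hT : MeasurePreserving T ν ν)
    (hf : Integrable f ν) (n : ℕ) : Integrable (maxBirkhoffSum T f n) ν := by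
  induction n with
  | zero => exact integrable_zero _ _ _
  | succ n ih => exact (integrable_zero _ _ _).sup (hf.add (hT.integrable_comp_of_integrable ih))

/-- Along almost every orbit, the Birkhoff sums of a function of negative mean are bounded above.
The set where the maximal sums `M n` are unbounded is invariant. If it had full measure, then
`M (n + 1) - M n ∘ T = max (-M n ∘ T) f` would converge to `f`, whereas the integrals of these
differences are nonnegative. -/
lemma ae_bddAbove_birkhoffSum [IsProbabilityMeasure ν] (hT : Ergodic T ν) (hf : Measurable f)
    (hfi : Integrable f ν) (hneg : ∫ x, f x ∂ν < 0) :
    ∀ᵐ x ∂ν, BddAbove (Set.range fun n => birkhoffSum T f n x) := by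
  set E : Set Ω := {x | BddAbove (Set.range fun n => maxBirkhoffSum T f n x)}
  have hE : MeasurableSet E :=
    measurableSet_bddAbove_range fun n => measurable_maxBirkhoffSum hT.measurable hf n
  have hinv : T ⁻¹' E = E := by
    ext x
    simp only [E, Set.mem_preimage, Set.mem_ofPred_eq]
    constructor
    · rintro ⟨b, hb⟩
      refine ⟨max 0 (f x + b), ?_⟩
      rintro _ ⟨n, rfl⟩
      refine (monotone_maxBirkhoffSum x n.le_succ).trans ?_
      have : maxBirkhoffSum T f n (T x) ≤ b := hb ⟨n, rfl⟩
      simp only [maxBirkhoffSum]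
      gcongr
    · rintro ⟨b, hb⟩
      refine ⟨b - f x, ?_⟩
      rintro _ ⟨n, rfl⟩
      have h1 : maxBirkhoffSum T f (n + 1) x ≤ b := hb ⟨n + 1, rfl⟩
      have h2 : f x + maxBirkhoffSum T f n (T x) ≤ maxBirkhoffSum T f (n + 1) x :=
        le_max_right _ _
      simp only
      linarith
  rcases hT.toPreErgodic.ae_mem_or_ae_notMem hE hinv with h | h
  · filter_upwards [h] with x hx
    obtain ⟨b, hb⟩ := hx
    refine ⟨b, ?_⟩
    rintro _ ⟨n, rfl⟩
    exact (birkhoffSum_le_maxBirkhoffSum n x).trans (hb ⟨n, rfl⟩)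
  · exfalso
    have hint := integrable_maxBirkhoffSum hT.toMeasurePreserving hfi
    have hintT (n : ℕ) : Integrable (fun x => maxBirkhoffSum T f n (T x)) ν :=
      hT.toMeasurePreserving.integrable_comp_of_integrable (hint n)
    have hlim : Tendsto (fun n => ∫ x, max (-maxBirkhoffSum T f n (T x)) (f x) ∂ν) atTop
        (𝓝 (∫ x, f x ∂ν)) := by
      refine tendsto_integral_of_dominated_convergence (fun x => |f x|) (fun n => ?_) hfi.abs
        (fun n => ?_) ?_
      · exact ((hintT n).neg.sup hfi).aestronglyMeasurable
      · refine ae_of_all _ fun x => ?_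
        have := maxBirkhoffSum_nonneg (T := T) (f := f) n (T x)
        rw [Real.norm_eq_abs, abs_le]
        exact ⟨(neg_abs_le _).trans (le_max_right _ _),
          max_le (by linarith [abs_nonneg (f x)]) (le_abs_self _)⟩
      · filter_upwards [h] with x hx
        have hTx : ¬ BddAbove (Set.range fun n => maxBirkhoffSum T f n (T x)) := by
          rw [← hinv] at hx
          exact hx
        have htop := tendsto_atTop_atTop_of_monotone' (monotone_maxBirkhoffSum (T x)) hTx
        refine tendsto_const_nhds.congr' ?_
        filter_upwards [htop.eventually_ge_atTop (-f x)] with n hn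
        rw [max_eq_right (by linarith)]
    refine hneg.not_ge (ge_of_tendsto' hlim fun n => ?_)
    simp_rw [← maxBirkhoffSum_succ_sub]
    rw [integral_sub (hint _) (hintT n), sub_nonneg]
    have hcomp : ∫ x, maxBirkhoffSum T f n (T x) ∂ν = ∫ x, maxBirkhoffSum T f n x ∂ν := by
      rw [← integral_map hT.measurable.aemeasurable, hT.map_eq]
      rw [hT.map_eq]
      exact (hint n).aestronglyMeasurable
    rw [hcomp]
    exact integral_mono (hint n) (hint (n + 1)) fun x => monotone_maxBirkhoffSum x n.le_succ

lemma ae_eventually_birkhoffAverage_lt [IsProbabilityMeasure ν] (hT : Ergodic T ν)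
    (hf : Measurable f) (hfi : Integrable f ν) {c : ℝ} (hc : ∫ x, f x ∂ν < c) :
    ∀ᵐ x ∂ν, ∀ᶠ n in atTop, birkhoffAverage ℝ T f n x < c := by
  obtain ⟨d, hd, hdc⟩ := exists_between hc
  -- The Birkhoff sums of `f - d` are bounded by some `b`, so the averages of `f` are at most
  -- `b / n + d`.
  have hneg : ∫ x, (f x - d) ∂ν < 0 := by
    rw [integral_sub hfi (integrable_const _)]
    simpa using hd
  filter_upwards [ae_bddAbove_birkhoffSum hT (hf.sub_const d) (hfi.sub (integrable_const d)) hneg]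
    with x ⟨b, hb⟩
  have hlim : Tendsto (fun n : ℕ => b / n + d) atTop (𝓝 (0 + d)) :=
    (tendsto_const_div_atTop_nhds_zero_nat b).add_const d
  filter_upwards [hlim.eventually_lt_const (by simpa using hdc), eventually_gt_atTop 0] with n hn hn0
  refine lt_of_le_of_lt ?_ hn
  have hsum : birkhoffSum T f n x - n * d ≤ b := by
    refine le_trans (le_of_eq ?_) (hb ⟨n, rfl⟩)
    simp [birkhoffSum, Finset.sum_sub_distrib]
  have hn' : (0 : ℝ) < n := by exact_mod_cast hn0
  rw [birkhoffAverage, smul_eq_mul, ← sub_le_iff_le_add, inv_mul_eq_div, div_sub' hn'.ne']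
  gcongr

/-- Birkhoff's pointwise ergodic theorem for an ergodic map of a probability space. -/
theorem ae_tendsto_birkhoffAverage [IsProbabilityMeasure ν] (hT : Ergodic T ν)
    (hf : Measurable f) (hfi : Integrable f ν) :
    ∀ᵐ x ∂ν, Tendsto (fun n => birkhoffAverage ℝ T f n x) atTop (𝓝 (∫ y, f y ∂ν)) := by
  obtain ⟨u, -, hu, hulim⟩ := exists_seq_strictAnti_tendsto (0 : ℝ)
  have h1 : ∀ᵐ x ∂ν, ∀ k, ∀ᶠ n in atTop, birkhoffAverage ℝ T f n x < ∫ y, f y ∂ν + u k :=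
    ae_all_iff.2 fun k => ae_eventually_birkhoffAverage_lt hT hf hfi (by linarith [hu k])
  have h2 : ∀ᵐ x ∂ν, ∀ k, ∀ᶠ n in atTop,
      birkhoffAverage ℝ T (fun y => -f y) n x < -∫ y, f y ∂ν + u k :=
    ae_all_iff.2 fun k => ae_eventually_birkhoffAverage_lt hT hf.neg hfi.neg
      (by rw [Pi.neg_def, integral_neg]; linarith [hu k])
  filter_upwards [h1, h2] with x hx1 hx2
  have hneg (n : ℕ) : birkhoffAverage ℝ T (fun y => -f y) n x = -birkhoffAverage ℝ T f n x := by
    simp [birkhoffAverage, birkhoffSum]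
  refine tendsto_order.2 ⟨fun a ha => ?_, fun a ha => ?_⟩
  · obtain ⟨k, hk⟩ := (hulim.eventually_lt_const (sub_pos.2 ha)).exists
    filter_upwards [hx2 k] with n hn
    rw [hneg] at hn
    linarith
  · obtain ⟨k, hk⟩ := (hulim.eventually_lt_const (sub_pos.2 ha)).exists
    filter_upwards [hx1 k] with n hn
    linarith

end Ergodic

/-! ### The natural measure as an image of Haar measure -/

/-- The map `θ ↦ sin² (π θ)`, written as `(1 - cos (2 π θ)) / 2`. -/
noncomputable def angleMap (θ : ℝ) : ℝ := (1 - Real.cos (2 * Real.pi * θ)) / 2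

lemma periodic_angleMap : Function.Periodic angleMap 1 := fun θ => by
  unfold angleMap
  rw [mul_add, mul_one, Real.cos_add_two_pi]

lemma angleMap_two_mul (θ : ℝ) : angleMap (2 * θ) = logisticMap (angleMap θ) := by
  have h : 2 * Real.pi * (2 * θ) = 2 * (2 * Real.pi * θ) := by ring
  simp only [angleMap, logisticMap, h, Real.cos_two_mul]
  ring

lemma continuous_angleMap : Continuous angleMap := by
  unfold angleMap
  fun_prop

lemma continuous_logisticMap : Continuous logisticMap := by
  unfold logisticMap
  fun_prop

lemma hasDerivAt_angleMap (θ : ℝ) :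
    HasDerivAt angleMap (Real.pi * Real.sin (2 * Real.pi * θ)) θ := by
  have h := (((hasDerivAt_id θ).const_mul (2 * Real.pi)).cos.const_sub 1).div_const 2
  refine h.congr_deriv ?_
  simp only [id]
  ring

/-- `angleMap` as a function on the circle, where it semiconjugates doubling to the logistic
map. -/
noncomputable def circleMap : UnitAddCircle → ℝ := periodic_angleMap.lift

lemma circleMap_coe (θ : ℝ) : circleMap (θ : UnitAddCircle) = angleMap θ :=
  periodic_angleMap.lift_coe θ

lemma measurable_circleMap : Measurable circleMap :=
  (show Continuous circleMap from continuous_coinduced_dom.2 continuous_angleMap).measurable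

lemma semiconj_circleMap :
    Function.Semiconj circleMap (fun y : UnitAddCircle => 2 • y) logisticMap := by
  intro y
  induction y using QuotientAddGroup.induction_on with
  | H θ =>
    have h : (2 • (θ : UnitAddCircle)) = ((2 * θ : ℝ) : UnitAddCircle) := by
      rw [two_mul, two_nsmul, AddCircle.coe_add]
    change circleMap (2 • (θ : UnitAddCircle)) = logisticMap (circleMap (θ : UnitAddCircle))
    rw [h, circleMap_coe, circleMap_coe, angleMap_two_mul]

lemma two_pi_mul_mem {θ : ℝ} (h : θ ∈ Set.Ioo (0 : ℝ) (1 / 2)) :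
    2 * Real.pi * θ ∈ Set.Ioo 0 Real.pi :=
  ⟨by have := h.1; positivity, by nlinarith [h.2, Real.pi_pos]⟩

lemma injOn_angleMap : Set.InjOn angleMap (Set.Ioo 0 (1 / 2)) := by
  intro a ha b hb hab
  have h : Real.cos (2 * Real.pi * a) = Real.cos (2 * Real.pi * b) := by
    simp only [angleMap] at hab
    linarith
  have := Real.injOn_cos (Set.Ioo_subset_Icc_self (two_pi_mul_mem ha))
    (Set.Ioo_subset_Icc_self (two_pi_mul_mem hb)) h
  exact mul_left_cancel₀ (by positivity) this

lemma image_angleMap : angleMap '' Set.Ioo 0 (1 / 2) = Set.Ioo 0 1 := by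
  ext x
  constructor
  · rintro ⟨θ, hθ, rfl⟩
    have h := two_pi_mul_mem hθ
    have hs := Real.sin_pos_of_mem_Ioo h
    have := Real.sin_sq_add_cos_sq (2 * Real.pi * θ)
    simp only [angleMap, Set.mem_Ioo]
    constructor <;> nlinarith
  · intro hx
    have h0 : 0 < Real.arccos (1 - 2 * x) := Real.arccos_pos.2 (by linarith [hx.1])
    have h1 : Real.arccos (1 - 2 * x) < Real.pi := by
      refine lt_of_le_of_ne (Real.arccos_le_pi _) fun h => ?_
      rw [Real.arccos_eq_pi] at h
      linarith [hx.2]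
    refine ⟨Real.arccos (1 - 2 * x) / (2 * Real.pi), ⟨by positivity, ?_⟩, ?_⟩
    · rw [div_lt_div_iff₀ (by positivity) (by norm_num)]
      linarith
    · rw [angleMap, mul_div_cancel₀ _ (by positivity), Real.cos_arccos] <;> linarith [hx.1, hx.2]

lemma ofReal_abs_deriv_mul_density {θ : ℝ} (hθ : θ ∈ Set.Ioo (0 : ℝ) (1 / 2)) :
    ENNReal.ofReal |Real.pi * Real.sin (2 * Real.pi * θ)| *
      ENNReal.ofReal (1 / (Real.pi * Real.sqrt (angleMap θ * (1 - angleMap θ)))) = 2 := by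
  have hs := Real.sin_pos_of_mem_Ioo (two_pi_mul_mem hθ)
  have h : angleMap θ * (1 - angleMap θ) = (Real.sin (2 * Real.pi * θ) / 2) ^ 2 := by
    have := Real.sin_sq_add_cos_sq (2 * Real.pi * θ)
    simp only [angleMap]
    linear_combination (-1 / 4) * this
  rw [h, Real.sqrt_sq (by positivity), abs_of_pos (by positivity),
    ← ENNReal.ofReal_mul (by positivity)]
  rw [show Real.pi * Real.sin (2 * Real.pi * θ) *
      (1 / (Real.pi * (Real.sin (2 * Real.pi * θ) / 2))) = 2 by
    generalize Real.sin (2 * Real.pi * θ) = t at hs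
    field_simp]
  simp

lemma naturalMeasure_apply {s : Set ℝ} (hs : MeasurableSet s) :
    naturalMeasure s = 2 * volume (angleMap ⁻¹' s ∩ Set.Ioo 0 (1 / 2)) := by
  have hsub : angleMap ⁻¹' s ∩ Set.Ioo 0 (1 / 2) ⊆ Set.Ioo 0 (1 / 2) := Set.inter_subset_right
  have hm : MeasurableSet (angleMap ⁻¹' s ∩ Set.Ioo 0 (1 / 2)) :=
    (continuous_angleMap.measurable hs).inter measurableSet_Ioo
  rw [naturalMeasure, withDensity_apply _ hs, Measure.restrict_restrict hs, ← image_angleMap,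
    ← Set.image_preimage_inter,
    lintegral_image_eq_lintegral_abs_deriv_mul hm
      (fun θ _ => (hasDerivAt_angleMap θ).hasDerivWithinAt) (injOn_angleMap.mono hsub),
    setLIntegral_congr_fun hm fun θ hθ => ofReal_abs_deriv_mul_density (hsub hθ)]
  simp

/-- The natural measure is the distribution of `sin² (π θ)` for a uniformly distributed angle
`θ`. -/
lemma measurePreserving_circleMap : MeasurePreserving circleMap volume naturalMeasure := by
  refine ⟨measurable_circleMap, ?_⟩
  ext s hs
  have hpre : MeasurableSet (angleMap ⁻¹' s) := continuous_angleMap.measurable hs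
  rw [Measure.map_apply measurable_circleMap hs,
    ← (UnitAddCircle.measurePreserving_mk (-(1 / 2))).measure_preimage
      (measurable_circleMap hs).nullMeasurableSet]
  have hcomp : ((↑) : ℝ → UnitAddCircle) ⁻¹' (circleMap ⁻¹' s) = angleMap ⁻¹' s := by
    ext θ
    simp [circleMap_coe]
  have hneg : Neg.neg ⁻¹' (angleMap ⁻¹' s ∩ Set.Ioo 0 (1 / 2)) =
      angleMap ⁻¹' s ∩ Set.Ioo (-(1 / 2)) 0 := by
    ext θ
    simp only [Set.mem_preimage, Set.mem_inter_iff, Set.mem_Ioo, angleMap, mul_neg, Real.cos_neg]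
    constructor <;> rintro ⟨h, h1, h2⟩ <;> exact ⟨h, by linarith, by linarith⟩
  have hsplit : (Set.Ioc (-(1 / 2)) (-(1 / 2) + 1) : Set ℝ) =ᵐ[volume]
      (Set.Ioo (-(1 / 2)) 0 ∪ Set.Ioo 0 (1 / 2) : Set ℝ) := by
    have h : (Set.Ioc (-(1 / 2)) (-(1 / 2) + 1) : Set ℝ) =
        Set.Ioc (-(1 / 2)) 0 ∪ Set.Ioc 0 (1 / 2) := by
      rw [Set.Ioc_union_Ioc_eq_Ioc (by norm_num) (by norm_num)]
      norm_num
    rw [h]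
    exact Ioo_ae_eq_Ioc.symm.union Ioo_ae_eq_Ioc.symm
  rw [hcomp, Measure.restrict_congr_set hsplit, Measure.restrict_apply hpre,
    Set.inter_union_distrib_left, measure_union _ (hpre.inter measurableSet_Ioo), ← hneg,
    Measure.measure_preimage_neg, naturalMeasure_apply hs, two_mul]
  refine Set.disjoint_left.2 ?_
  rintro θ ⟨-, h1⟩ ⟨-, h2⟩
  exact lt_asymm h1.2 h2.1

instance : IsProbabilityMeasure naturalMeasure :=
  ⟨by rw [← measurePreserving_circleMap.measure_preimage nullMeasurableSet_univ, Set.preimage_univ,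
    UnitAddCircle.measure_univ]⟩

lemma ergodic_logisticMap : Ergodic logisticMap naturalMeasure :=
  measurePreserving_circleMap.ergodic_of_ergodic_semiconj
    (AddCircle.ergodic_nsmul (T := 1) one_lt_two) continuous_logisticMap.measurable
    semiconj_circleMap

instance : NullSingletonClass naturalMeasure := by
  unfold naturalMeasure
  infer_instance

lemma ae_mem_Ioo : ∀ᵐ x ∂naturalMeasure, x ∈ Set.Ioo (0 : ℝ) 1 :=
  (withDensity_absolutelyContinuous _ _).ae_le (ae_restrict_mem measurableSet_Ioo)

lemma restrict_Icc_absolutelyContinuous :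
    volume.restrict (Set.Icc (0 : ℝ) 1) ≪ naturalMeasure := by
  rw [← Measure.restrict_congr_set (Ioo_ae_eq_Icc (μ := volume) (a := (0 : ℝ)) (b := 1))]
  refine withDensity_absolutelyContinuous' (Measurable.aemeasurable ?_) ?_
  · fun_prop
  · filter_upwards [ae_restrict_mem measurableSet_Ioo] with x hx
    have h1 := hx.1
    have h2 : 0 < 1 - x := sub_pos.2 hx.2
    rw [Ne, ENNReal.ofReal_eq_zero, not_le]
    positivity

/-- The natural measure is symmetric about `1 / 2`. -/
lemma measurePreserving_one_sub :
    MeasurePreserving (fun x : ℝ => 1 - x) naturalMeasure naturalMeasure := by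
  have hmeas : Measurable fun x : ℝ => 1 - x := by fun_prop
  have hhalf : MeasurePreserving (fun y : UnitAddCircle => ((1 / 2 : ℝ) : UnitAddCircle) + y)
      volume volume := measurePreserving_add_left _ _
  have hsemi : Function.Semiconj circleMap
      (fun y : UnitAddCircle => ((1 / 2 : ℝ) : UnitAddCircle) + y) (fun x : ℝ => 1 - x) := by
    intro y
    induction y using QuotientAddGroup.induction_on with
    | H θ =>
      change circleMap (((1 / 2 : ℝ) : UnitAddCircle) + (θ : UnitAddCircle)) =
        1 - circleMap (θ : UnitAddCircle)
      rw [← AddCircle.coe_add, circleMap_coe, circleMap_coe, angleMap, angleMap,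
        show 2 * Real.pi * (1 / 2 + θ) = 2 * Real.pi * θ + Real.pi by ring, Real.cos_add_pi]
      ring
  exact measurePreserving_circleMap.of_semiconj hhalf hsemi hmeas

lemma logisticMap_one_sub (x : ℝ) : logisticMap (1 - x) = logisticMap x := by
  unfold logisticMap
  ring

lemma measure_preimage_inter_Ici {s : Set ℝ} (hs : MeasurableSet s) :
    naturalMeasure (logisticMap ⁻¹' s ∩ Set.Ici (1 / 2)) =
      naturalMeasure (logisticMap ⁻¹' s ∩ Set.Iio (1 / 2)) := by
  have h : (fun x : ℝ => 1 - x) ⁻¹' (logisticMap ⁻¹' s ∩ Set.Iio (1 / 2)) =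
      logisticMap ⁻¹' s ∩ Set.Ioi (1 / 2) := by
    ext x
    simp only [Set.mem_preimage, Set.mem_inter_iff, logisticMap_one_sub, Set.mem_Iio, Set.mem_Ioi]
    constructor <;> rintro ⟨h1, h2⟩ <;> exact ⟨h1, by linarith⟩
  rw [← measurePreserving_one_sub.measure_preimage
    ((continuous_logisticMap.measurable hs).inter measurableSet_Iio).nullMeasurableSet, h]
  exact measure_congr ((ae_eq_refl _).inter Ioi_ae_eq_Ici.symm)

/-- Each of the two monotone branches of the logistic map carries half of the natural measure:
the branches are interchanged by the symmetry `x ↦ 1 - x`. -/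
lemma two_mul_measure_preimage_inter_branch {s : Set ℝ} (hs : MeasurableSet s) (b : Bool) :
    2 * naturalMeasure (logisticMap ⁻¹' s ∩ {x | decide (1 / 2 ≤ x) = b}) = naturalMeasure s := by
  have hsum : naturalMeasure s = naturalMeasure (logisticMap ⁻¹' s ∩ Set.Iio (1 / 2)) +
      naturalMeasure (logisticMap ⁻¹' s ∩ Set.Ici (1 / 2)) := by
    rw [← ergodic_logisticMap.measure_preimage hs.nullMeasurableSet,
      ← measure_inter_add_sdiff (logisticMap ⁻¹' s) (measurableSet_Iio (a := (1 / 2 : ℝ))),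
      Set.sdiff_eq, Set.compl_Iio]
  cases b with
  | false =>
    have h : {x : ℝ | decide (1 / 2 ≤ x) = false} = Set.Iio (1 / 2) := by ext; simp
    rw [h, hsum, measure_preimage_inter_Ici hs, two_mul]
  | true =>
    have h : {x : ℝ | decide (1 / 2 ≤ x) = true} = Set.Ici (1 / 2) := by ext; simp
    rw [h, hsum, measure_preimage_inter_Ici hs, two_mul]

/-! ### Cylinders and their probabilities -/

lemma logisticMap_mem_Icc {x : ℝ} (hx : x ∈ Set.Icc (0 : ℝ) 1) :
    logisticMap x ∈ Set.Icc (0 : ℝ) 1 := by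
  obtain ⟨h0, h1⟩ := hx
  unfold logisticMap
  constructor <;> nlinarith [sq_nonneg (2 * x - 1)]

lemma iterate_logisticMap_mem_Icc {x : ℝ} (hx : x ∈ Set.Icc (0 : ℝ) 1) (n : ℕ) :
    logisticMap^[n] x ∈ Set.Icc (0 : ℝ) 1 :=
  (show Set.MapsTo logisticMap (Set.Icc 0 1) (Set.Icc 0 1) from
    fun _ => logisticMap_mem_Icc).iterate n hx

lemma blockAt_symbolSeq (x : ℝ) (m n : ℕ) :
    blockAt (symbolSeq x) m n = blockAt (symbolSeq (logisticMap^[n] x)) m 0 := by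
  ext i
  simp only [blockAt, symbolSeq, zero_add]
  rw [← Function.iterate_add_apply, add_comm]

lemma blockAt_symbolSeq_succ (x : ℝ) (m : ℕ) :
    blockAt (symbolSeq x) (m + 1) 0 =
      Matrix.vecCons (quarterSymbol x) (blockAt (symbolSeq (logisticMap x)) m 0) := by
  ext i
  refine Fin.cases ?_ (fun j => ?_) i
  · simp [blockAt, symbolSeq]
  · simp [blockAt, symbolSeq]

lemma vecCons_mem_cylinder {x : ℝ} (hx : x ∈ Set.Icc (0 : ℝ) 1) {m : ℕ} (s : QuarterSymbol)
    (w : Fin m → QuarterSymbol) :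
    x ∈ cylinder (Matrix.vecCons s w) ↔ quarterSymbol x = s ∧ logisticMap x ∈ cylinder w := by
  simp only [cylinder, Set.mem_ofPred_eq, hx, logisticMap_mem_Icc hx, true_and,
    blockAt_symbolSeq_succ, Matrix.vecCons_inj]

lemma measurableSet_quarterSymbol_eq (s : QuarterSymbol) :
    MeasurableSet {x | quarterSymbol x = s} := by
  let _ : MeasurableSpace QuarterSymbol := ⊤
  have h : Measurable quarterSymbol :=
    .ite measurableSet_Iio measurable_const <| .ite measurableSet_Iio measurable_const <|
      .ite measurableSet_Iic measurable_const measurable_const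
  exact h (t := {s}) trivial

lemma measurableSet_cylinder {m : ℕ} (w : Fin m → QuarterSymbol) :
    MeasurableSet (cylinder w) := by
  have h : cylinder w = Set.Icc 0 1 ∩
      ⋂ i : Fin m, logisticMap^[i] ⁻¹' {x | quarterSymbol x = w i} := by
    ext x
    simp [cylinder, blockAt, symbolSeq, funext_iff]
  rw [h]
  exact measurableSet_Icc.inter <| .iInter fun i =>
    (continuous_logisticMap.iterate i).measurable (measurableSet_quarterSymbol_eq _)

/-- The cylinders of the blocks of a given size partition the interval. -/
lemma sum_blockProb (m : ℕ) : ∑ w : Fin m → QuarterSymbol, blockProb w = 1 := by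
  have hU : (⋃ w ∈ (Finset.univ : Finset (Fin m → QuarterSymbol)), cylinder w) = Set.Icc 0 1 := by
    ext x
    simp [cylinder]
  simp only [blockProb]
  rw [← measureReal_biUnion_finset, hU]
  · have h1 : naturalMeasure (Set.Icc 0 1) = 1 := by
      rw [← mem_ae_iff_prob_eq_one measurableSet_Icc]
      exact Filter.mem_of_superset ae_mem_Ioo Set.Ioo_subset_Icc_self
    rw [measureReal_def, h1, ENNReal.toReal_one]
  · intro v _ w _ hvw
    refine Set.disjoint_left.2 fun x hv hw => hvw ?_
    exact hv.2.symm.trans hw.2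
  · exact fun w _ => measurableSet_cylinder w

/-- The two symbols that can precede `t` along a typical orbit: `predSymbol false t` is the one in
the left half of the interval and `predSymbol true t` the one in the right half. -/
def predSymbol (b : Bool) : QuarterSymbol → QuarterSymbol
  | .D => if b then .C else .B
  | _ => if b then .D else .A

lemma predSymbol_injective (t : QuarterSymbol) : Function.Injective fun b => predSymbol b t := by
  intro a b h
  cases t <;> cases a <;> cases b <;> simp_all [predSymbol]

/-- The value `3 / 4` is excluded because there the closed right end of the third interval breaks
the Markov property of the partition. -/
lemma quarterSymbol_eq_predSymbol {x : ℝ} (h : logisticMap x ≠ 3 / 4) :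
    quarterSymbol x = predSymbol (decide (1 / 2 ≤ x)) (quarterSymbol (logisticMap x)) := by
  have hfac : logisticMap x - 3 / 4 = (4 * x - 1) * (3 - 4 * x) / 4 := by
    unfold logisticMap
    ring
  have h1 : x ≠ 1 / 4 := by rintro rfl; norm_num [logisticMap] at h
  have h3 : x ≠ 3 / 4 := by rintro rfl; norm_num [logisticMap] at h
  have hpred : ∀ b, (3 / 4 < logisticMap x →
      predSymbol b (quarterSymbol (logisticMap x)) = if b then .C else .B) ∧
      (logisticMap x ≤ 3 / 4 →
      predSymbol b (quarterSymbol (logisticMap x)) = if b then .D else .A) := by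
    intro b
    constructor
    · intro hy
      have : quarterSymbol (logisticMap x) = .D := by
        unfold quarterSymbol
        rw [if_neg (by linarith), if_neg (by linarith), if_neg (by linarith)]
      rw [this, predSymbol]
    · intro hy
      unfold quarterSymbol
      split_ifs <;> simp_all [predSymbol]
  by_cases ha : x < 1 / 4
  · rw [(hpred _).2 (by nlinarith)]
    simp only [quarterSymbol, ha, show ¬ (1 / 2 ≤ x) by linarith, if_true]
    simp
  have ha' : 1 / 4 < x := lt_of_le_of_ne (not_lt.1 ha) h1.symm
  by_cases hb : x < 1 / 2
  · rw [(hpred _).1 (by nlinarith)]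
    simp only [quarterSymbol, ha, hb, show ¬ (1 / 2 ≤ x) by linarith, if_true, if_false]
    simp
  by_cases hc : x ≤ 3 / 4
  · have hc' : x < 3 / 4 := lt_of_le_of_ne hc h3
    rw [(hpred _).1 (by nlinarith)]
    simp only [quarterSymbol, ha, hb, hc, not_lt.1 hb, if_true, if_false]
    simp
  · rw [(hpred _).2 (by nlinarith)]
    simp only [quarterSymbol, ha, hb, hc, not_lt.1 hb, if_false]
    simp

lemma ae_logisticMap_ne (y : ℝ) : ∀ᵐ x ∂naturalMeasure, logisticMap x ≠ y :=
  ergodic_logisticMap.quasiMeasurePreserving.ae (Measure.ae_ne naturalMeasure y)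

/-- Up to a null set, prepending the symbol `s` to the block `w` intersects the preimage of the
cylinder of `w` with a union of branches that depends only on `s` and the first symbol of `w`. -/
lemma vecCons_cylinder_ae_eq {m : ℕ} (s : QuarterSymbol) (w : Fin (m + 1) → QuarterSymbol) :
    cylinder (Matrix.vecCons s w) =ᵐ[naturalMeasure]
      (logisticMap ⁻¹' cylinder w ∩ {x | predSymbol (decide (1 / 2 ≤ x)) (w 0) = s} : Set ℝ) := by
  filter_upwards [ae_mem_Ioo, ae_logisticMap_ne (3 / 4)] with x hx hne
  refine propext ((vecCons_mem_cylinder (Set.Ioo_subset_Icc_self hx) s w).trans ?_)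
  rw [quarterSymbol_eq_predSymbol hne, and_comm]
  refine and_congr_right fun hw => ?_
  have h0 : quarterSymbol (logisticMap x) = w 0 := by
    rw [← hw.2]
    simp [blockAt, symbolSeq]
  rw [h0]
  rfl

lemma blockProb_vecCons_predSymbol {m : ℕ} (b : Bool) (w : Fin (m + 1) → QuarterSymbol) :
    blockProb (Matrix.vecCons (predSymbol b (w 0)) w) = blockProb w / 2 := by
  have hset : {x : ℝ | predSymbol (decide (1 / 2 ≤ x)) (w 0) = predSymbol b (w 0)} =
      {x | decide (1 / 2 ≤ x) = b} := by
    ext x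
    exact (predSymbol_injective (w 0)).eq_iff
  have h := two_mul_measure_preimage_inter_branch (measurableSet_cylinder w) b
  rw [blockProb, measureReal_congr (vecCons_cylinder_ae_eq _ w), hset, blockProb, measureReal_def,
    measureReal_def, ← h, ENNReal.toReal_mul]
  simp

lemma exists_predSymbol_of_blockProb_ne_zero {m : ℕ} {s : QuarterSymbol}
    {w : Fin (m + 1) → QuarterSymbol} (h : blockProb (Matrix.vecCons s w) ≠ 0) :
    ∃ b, predSymbol b (w 0) = s := by
  by_contra! hb
  refine h ?_
  have hset : {x : ℝ | predSymbol (decide (1 / 2 ≤ x)) (w 0) = s} = ∅ :=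
    Set.eq_empty_of_forall_notMem fun x => hb _
  rw [blockProb, measureReal_congr (vecCons_cylinder_ae_eq _ w), hset]
  simp

lemma blockProb_singleton_pos (s : QuarterSymbol) : 0 < blockProb ![s] := by
  obtain ⟨a, b, hab, h0, h1, hs⟩ : ∃ a b : ℝ, a < b ∧ 0 ≤ a ∧ b ≤ 1 ∧
      ∀ x ∈ Set.Ioo a b, quarterSymbol x = s := by
    cases s
    · refine ⟨0, 1 / 4, by norm_num, by norm_num, by norm_num, fun x hx => ?_⟩
      rw [quarterSymbol, if_pos hx.2]
    · refine ⟨1 / 4, 1 / 2, by norm_num, by norm_num, by norm_num, fun x hx => ?_⟩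
      rw [quarterSymbol, if_neg hx.1.not_gt, if_pos hx.2]
    · refine ⟨1 / 2, 3 / 4, by norm_num, by norm_num, by norm_num, fun x hx => ?_⟩
      rw [quarterSymbol, if_neg (by linarith [hx.1]), if_neg hx.1.not_gt, if_pos hx.2.le]
    · refine ⟨3 / 4, 1, by norm_num, by norm_num, by norm_num, fun x hx => ?_⟩
      rw [quarterSymbol, if_neg (by linarith [hx.1]), if_neg (by linarith [hx.1]),
        if_neg hx.1.not_ge]
  have hsub : Set.Ioo a b ⊆ Set.Icc 0 1 :=
    fun x hx => ⟨h0.trans hx.1.le, hx.2.le.trans h1⟩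
  have hcyl : Set.Ioo a b ⊆ cylinder ![s] := fun x hx => by
    rw [vecCons_mem_cylinder (hsub hx)]
    exact ⟨hs x hx, logisticMap_mem_Icc (hsub hx), Subsingleton.elim _ _⟩
  refine lt_of_le_of_ne measureReal_nonneg fun h' => ?_
  have h : naturalMeasure (cylinder ![s]) = 0 := (measureReal_eq_zero_iff (by finiteness)).1 h'.symm
  have hnull := restrict_Icc_absolutelyContinuous (measure_mono_null hcyl h)
  rw [Measure.restrict_apply measurableSet_Ioo, Set.inter_eq_left.2 hsub, Real.volume_Ioo,
    ENNReal.ofReal_eq_zero] at hnull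
  linarith

lemma fin_one_block_eq (w : Fin 1 → QuarterSymbol) : w = ![w 0] := by
  ext i
  rw [Subsingleton.elim i 0]
  rfl

/-- Every typical transition halves the probability. The symbol `s` is the last one of the block. -/
lemma blockProb_eq_zero_or_exists (m : ℕ) (w : Fin (m + 1) → QuarterSymbol) :
    blockProb w = 0 ∨ ∃ s, blockProb w = blockProb ![s] / 2 ^ m := by
  induction m with
  | zero =>
    refine .inr ⟨w 0, ?_⟩
    rw [pow_zero, div_one]
    exact congrArg blockProb (fin_one_block_eq w)
  | succ m ih =>
    rw [← Matrix.cons_head_tail w]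
    generalize Matrix.vecHead w = s
    generalize Matrix.vecTail w = v
    by_cases h : blockProb (Matrix.vecCons s v) = 0
    · exact .inl h
    obtain ⟨b, rfl⟩ := exists_predSymbol_of_blockProb_ne_zero h
    rw [blockProb_vecCons_predSymbol] at h ⊢
    refine .inr ?_
    rcases ih v with h' | ⟨t, ht⟩
    · simp [h'] at h
    · exact ⟨t, by rw [ht, pow_succ]; ring⟩

lemma blockProb_mem_Icc : ∃ c > 0, ∀ m ≥ 1, ∀ w : Fin m → QuarterSymbol,
    blockProb w ≠ 0 → c / 2 ^ m ≤ blockProb w ∧ blockProb w ≤ 2 / 2 ^ m := by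
  have : Nonempty QuarterSymbol := ⟨.A⟩
  obtain ⟨t, ht⟩ := Finite.exists_min fun s : QuarterSymbol => blockProb ![s]
  refine ⟨2 * blockProb ![t], by have := blockProb_singleton_pos t; positivity, ?_⟩
  rintro (_ | m) hm w hw
  · omega
  obtain ⟨s, hs⟩ := (blockProb_eq_zero_or_exists m w).resolve_left hw
  have h2 : blockProb w = 2 * blockProb ![s] / 2 ^ (m + 1) := by
    rw [hs, pow_succ]
    field_simp
  have h1 : blockProb ![s] ≤ 1 := measureReal_le_one
  rw [h2]
  constructor
  · gcongr
    exact ht s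
  · gcongr
    linarith

/-! ### Counting blocks -/

/-- The blocks of positive probability. -/
def typicalBlocks (m : ℕ) : Set (Fin m → QuarterSymbol) := {w | blockProb w ≠ 0}

/-- A block prolonged to the left by one of the two typical predecessors of its first symbol. -/
def prolong {m : ℕ} (p : Bool × (Fin (m + 1) → QuarterSymbol)) : Fin (m + 2) → QuarterSymbol :=
  Matrix.vecCons (predSymbol p.1 (p.2 0)) p.2

lemma prolong_injective (m : ℕ) : Function.Injective (prolong (m := m)) := by
  rintro ⟨a, v⟩ ⟨b, w⟩ h
  obtain ⟨h1, rfl⟩ := Matrix.vecCons_inj.1 h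
  exact congrArg (·, v) (predSymbol_injective _ h1)

lemma typicalBlocks_succ (m : ℕ) :
    typicalBlocks (m + 2) = prolong '' (Set.univ ×ˢ typicalBlocks (m + 1)) := by
  ext w
  constructor
  · intro hw
    rw [← Matrix.cons_head_tail w] at hw ⊢
    obtain ⟨b, hb⟩ := exists_predSymbol_of_blockProb_ne_zero hw
    rw [← hb] at hw ⊢
    refine ⟨(b, Matrix.vecTail w), ⟨trivial, fun h => hw ?_⟩, rfl⟩
    rw [blockProb_vecCons_predSymbol, h, zero_div]
  · rintro ⟨⟨b, v⟩, ⟨-, hv⟩, rfl⟩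
    have hv' : blockProb v ≠ 0 := hv
    change blockProb (Matrix.vecCons _ _) ≠ 0
    rw [blockProb_vecCons_predSymbol]
    positivity

lemma ncard_prolong_image {m : ℕ} (S : Set (Fin (m + 1) → QuarterSymbol)) :
    (prolong '' (Set.univ ×ˢ S)).ncard = 2 * S.ncard := by
  rw [Set.ncard_image_of_injective _ (prolong_injective m), Set.ncard_prod, Set.ncard_univ]
  simp

lemma card_quarterSymbol : Fintype.card QuarterSymbol = 4 := rfl

lemma ncard_typicalBlocks (m : ℕ) : (typicalBlocks (m + 1)).ncard = 2 ^ (m + 2) := by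
  induction m with
  | zero =>
    have h : typicalBlocks (0 + 1) = Set.univ := by
      refine Set.eq_univ_of_forall fun w => ?_
      rw [fin_one_block_eq w]
      exact (blockProb_singleton_pos _).ne'
    rw [h, Set.ncard_univ, Nat.card_eq_fintype_card, Fintype.card_fun, card_quarterSymbol]
    rfl
  | succ m ih => rw [typicalBlocks_succ, ncard_prolong_image, ih]; ring

lemma mem_mapAdmissibleBlocks {m : ℕ} {w : Fin m → QuarterSymbol} :
    w ∈ mapAdmissibleBlocks m ↔ (cylinder w).Nonempty := by
  simp only [mapAdmissibleBlocks, Set.mem_iUnion, admissibleBlocks]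
  constructor
  · rintro ⟨x, hx, n, rfl⟩
    exact ⟨_, iterate_logisticMap_mem_Icc hx n, (blockAt_symbolSeq x m n).symm⟩
  · rintro ⟨x, hx, h⟩
    exact ⟨x, hx, 0, h⟩

lemma typicalBlocks_subset_mapAdmissibleBlocks (m : ℕ) :
    typicalBlocks m ⊆ mapAdmissibleBlocks m := by
  intro w hw
  rw [mem_mapAdmissibleBlocks, Set.nonempty_iff_ne_empty]
  intro h
  exact hw (by rw [blockProb, h, measureReal_empty])

lemma blockAt_symbolSeq_three_quarters (m : ℕ) :
    blockAt (symbolSeq (3 / 4)) m 0 = fun _ => .C := by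
  have hfix : Function.IsFixedPt logisticMap (3 / 4) := by
    norm_num [Function.IsFixedPt, logisticMap]
  ext i
  simp only [blockAt, symbolSeq]
  rw [Function.iterate_fixed hfix]
  norm_num [quarterSymbol]

/-- The only way for an orbit to leave the typical transitions is through the fixed point `3 / 4`,
after which all symbols are `C`. -/
lemma mapAdmissibleBlocks_succ_subset (m : ℕ) :
    mapAdmissibleBlocks (m + 2) ⊆ prolong '' (Set.univ ×ˢ mapAdmissibleBlocks (m + 1)) ∪
      {Matrix.vecCons .B fun _ => .C, Matrix.vecCons .C fun _ => .C} := by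
  intro w hw
  obtain ⟨x, hx, rfl⟩ := mem_mapAdmissibleBlocks.1 hw
  rw [blockAt_symbolSeq_succ]
  by_cases h : logisticMap x = 3 / 4
  · refine .inr ?_
    rw [h, blockAt_symbolSeq_three_quarters]
    have hfac : (x - 1 / 4) * (x - 3 / 4) = 0 := by
      unfold logisticMap at h
      linear_combination (-1 / 4) * h
    rcases mul_eq_zero.1 hfac with h' | h'
    · left
      rw [sub_eq_zero.1 h']
      norm_num [quarterSymbol]
    · right
      rw [sub_eq_zero.1 h']
      norm_num [quarterSymbol]
  · refine .inl ⟨(decide (1 / 2 ≤ x), blockAt (symbolSeq (logisticMap x)) (m + 1) 0),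
      ⟨trivial, mem_mapAdmissibleBlocks.2 ⟨_, logisticMap_mem_Icc hx, rfl⟩⟩, ?_⟩
    rw [quarterSymbol_eq_predSymbol h]
    rfl

/-- The summand `2` on the left makes the recursion `N (m + 1) ≤ 2 N m + 2` an induction. -/
lemma ncard_mapAdmissibleBlocks_le (m : ℕ) :
    (mapAdmissibleBlocks (m + 1)).ncard + 2 ≤ 6 * 2 ^ m := by
  induction m with
  | zero =>
    have h : (mapAdmissibleBlocks (0 + 1)).ncard ≤ Nat.card (Fin (0 + 1) → QuarterSymbol) :=
      Set.ncard_le_card _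
    rw [Nat.card_eq_fintype_card, Fintype.card_fun, card_quarterSymbol] at h
    simpa using h
  | succ m ih =>
    have h1 := Set.ncard_le_ncard (mapAdmissibleBlocks_succ_subset m) (Set.toFinite _)
    have h2 := Set.ncard_union_le (prolong '' (Set.univ ×ˢ mapAdmissibleBlocks (m + 1)))
      {Matrix.vecCons .B fun _ => .C, Matrix.vecCons .C fun _ => .C}
    have h3 := Set.ncard_insert_le (Matrix.vecCons .B fun _ => .C : Fin (m + 2) → QuarterSymbol)
      {Matrix.vecCons .C fun _ => .C}
    rw [Set.ncard_singleton] at h3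
    rw [ncard_prolong_image] at h2
    rw [pow_succ]
    change (mapAdmissibleBlocks (m + 2)).ncard + 2 ≤ _
    omega

/-! ### Block entropies -/

lemma tendsto_div_natCast_of_abs_sub_le {u : ℕ → ℝ} {a B : ℝ}
    (h : ∀ m ≥ 1, |u m - m * a| ≤ B) : Tendsto (fun m : ℕ => u m / m) atTop (𝓝 a) := by
  rw [tendsto_iff_dist_tendsto_zero]
  refine squeeze_zero' (.of_forall fun _ => dist_nonneg) ?_
    (tendsto_const_div_atTop_nhds_zero_nat B)
  filter_upwards [eventually_ge_atTop 1] with m hm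
  have hm' : (0 : ℝ) < m := by exact_mod_cast hm
  rw [Real.dist_eq, div_sub' hm'.ne', abs_div, abs_of_pos hm']
  gcongr
  exact h m hm

section Entropy

variable {α : Type*} [Fintype α] {c C K β : ℝ}

lemma abs_shannonEntropy_sub_le {m : ℕ} {S : Set (Fin m → α)} {P : (Fin m → α) → ℝ} (hc : 0 < c)
    (hP : ∀ w, P w ≠ 0 → c / 2 ^ m ≤ P w ∧ P w ≤ C / 2 ^ m)
    (hS : ∀ w, P w ≠ 0 → w ∈ S) (hsum : ∑ w, P w = 1) :
    |renyiBlockEntropy S P 1 - m * Real.log 2| ≤ |Real.log c| + |Real.log C| := by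
  have hnonneg (w : Fin m → α) : 0 ≤ P w := by
    by_cases h : P w = 0
    · exact h.ge
    · exact le_trans (by positivity) (hP w h).1
  have hext : ∀ g : (Fin m → α) → ℝ, (∀ w, P w = 0 → g w = 0) →
      ∑ w ∈ S.toFinite.toFinset, g w = ∑ w, g w := fun g hg => by
    refine Finset.sum_subset (Finset.subset_univ _) fun w _ hw => hg w ?_
    by_contra h
    exact hw (by simpa using hS w h)
  have hterm (w : Fin m → α) :
      |P w * (-Real.log (P w) - m * Real.log 2)| ≤ P w * (|Real.log c| + |Real.log C|) := by
    by_cases h : P w = 0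
    · simp [h]
    rw [abs_mul, abs_of_nonneg (hnonneg w)]
    refine mul_le_mul_of_nonneg_left ?_ (hnonneg w)
    have hpos : 0 < P w := lt_of_le_of_ne (hnonneg w) (Ne.symm h)
    obtain ⟨h1, h2⟩ := hP w h
    have hC : 0 < C := by
      by_contra! hC
      exact (hpos.trans_le h2).not_ge (div_nonpos_of_nonpos_of_nonneg hC (by positivity))
    have l1 := Real.log_le_log (by positivity) h1
    have l2 := Real.log_le_log hpos h2
    rw [Real.log_div hc.ne' (by positivity), Real.log_pow] at l1
    rw [Real.log_div hC.ne' (by positivity), Real.log_pow] at l2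
    rw [abs_le]
    constructor <;> linarith [neg_abs_le (Real.log c), le_abs_self (Real.log C),
      abs_nonneg (Real.log c), abs_nonneg (Real.log C)]
  have heq : renyiBlockEntropy S P 1 - m * Real.log 2 =
      ∑ w, P w * (-Real.log (P w) - m * Real.log 2) := by
    rw [renyiBlockEntropy, if_pos rfl, hext _ fun w hw => by simp [hw]]
    simp only [mul_sub, Finset.sum_sub_distrib, ← Finset.sum_mul, hsum, one_mul, mul_neg,
      Finset.sum_neg_distrib]
  rw [heq]
  refine (Finset.abs_sum_le_sum_abs _ _).trans ((Finset.sum_le_sum fun w _ => hterm w).trans ?_)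
  rw [← Finset.sum_mul, hsum, one_mul]

lemma abs_log_sum_rpow_sub_le {m : ℕ} {S : Set (Fin m → α)} {P : (Fin m → α) → ℝ} (hc : 0 < c)
    (hC : 0 < C) (hK : 0 < K) (hβ : 0 ≤ β)
    (hP : ∀ w, P w ≠ 0 → c / 2 ^ m ≤ P w ∧ P w ≤ C / 2 ^ m)
    (hS : ∀ w, P w ≠ 0 → w ∈ S) (hlow : 2 ^ m ≤ {w | P w ≠ 0}.ncard)
    (hup : (S.ncard : ℝ) ≤ K * 2 ^ m) :
    |Real.log (∑ w ∈ S.toFinite.toFinset, P w ^ β) - m * ((1 - β) * Real.log 2)| ≤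
      |Real.log K| + β * (|Real.log c| + |Real.log C|) := by
  have hnonneg (w : Fin m → α) : 0 ≤ P w := by
    by_cases h : P w = 0
    · exact h.ge
    · exact le_trans (by positivity) (hP w h).1
  have hle (w : Fin m → α) : P w ≤ C / 2 ^ m := by
    by_cases h : P w = 0
    · rw [h]; positivity
    · exact (hP w h).2
  have hlower : (2 : ℝ) ^ m * (c / 2 ^ m) ^ β ≤ ∑ w ∈ S.toFinite.toFinset, P w ^ β := by
    have hsub : (Set.toFinite {w | P w ≠ 0}).toFinset ⊆ S.toFinite.toFinset := fun w hw => by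
      simpa using hS w (by simpa using hw)
    calc (2 : ℝ) ^ m * (c / 2 ^ m) ^ β
        ≤ ({w | P w ≠ 0}.ncard : ℝ) * (c / 2 ^ m) ^ β := by
          gcongr
          exact_mod_cast hlow
      _ = ∑ w ∈ (Set.toFinite {w | P w ≠ 0}).toFinset, (c / 2 ^ m) ^ β := by
          rw [Finset.sum_const, nsmul_eq_mul, Set.ncard_eq_toFinset_card]
      _ ≤ ∑ w ∈ (Set.toFinite {w | P w ≠ 0}).toFinset, P w ^ β := by
          refine Finset.sum_le_sum fun w hw => Real.rpow_le_rpow (by positivity) ?_ hβ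
          exact (hP w (by simpa using hw)).1
      _ ≤ _ := Finset.sum_le_sum_of_subset_of_nonneg hsub
          fun w _ _ => Real.rpow_nonneg (hnonneg w) _
  -- Blocks of probability zero contribute at most this much too, even for `β = 0`.
  have hupper : ∑ w ∈ S.toFinite.toFinset, P w ^ β ≤ K * 2 ^ m * (C / 2 ^ m) ^ β := by
    calc ∑ w ∈ S.toFinite.toFinset, P w ^ β
        ≤ ∑ w ∈ S.toFinite.toFinset, (C / 2 ^ m) ^ β :=
          Finset.sum_le_sum fun w _ => Real.rpow_le_rpow (hnonneg w) (hle w) hβ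
      _ = (S.ncard : ℝ) * (C / 2 ^ m) ^ β := by
          rw [Finset.sum_const, nsmul_eq_mul, Set.ncard_eq_toFinset_card]
      _ ≤ _ := by gcongr
  have l1 := Real.log_le_log (by positivity) hlower
  have l2 := Real.log_le_log (lt_of_lt_of_le (by positivity) hlower) hupper
  rw [Real.log_mul (by positivity) (by positivity), Real.log_rpow (by positivity),
    Real.log_div hc.ne' (by positivity), Real.log_pow] at l1
  rw [Real.log_mul (by positivity) (by positivity), Real.log_mul (by positivity) (by positivity),
    Real.log_rpow (by positivity), Real.log_div hC.ne' (by positivity), Real.log_pow] at l2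
  have e1 := mul_le_mul_of_nonneg_left (neg_abs_le (Real.log c)) hβ
  have e2 := mul_le_mul_of_nonneg_left (le_abs_self (Real.log C)) hβ
  have e3 := mul_nonneg hβ (abs_nonneg (Real.log c))
  have e4 := mul_nonneg hβ (abs_nonneg (Real.log C))
  rw [abs_le]
  constructor <;> linarith [le_abs_self (Real.log K), abs_nonneg (Real.log K)]

/-- If all nonzero probabilities of blocks of size `m` are of the order `2 ^ (-m)` and the number of
blocks, with or without those of probability zero, is of the order `2 ^ m`, then every Rényi entropy
rate equals `log 2`. -/
lemma tendsto_renyiBlockEntropy_div {S : ∀ m, Set (Fin m → α)}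
    {P : ∀ {m}, (Fin m → α) → ℝ} (hc : 0 < c) (hC : 0 < C) (hK : 0 < K) (hβ : 0 ≤ β)
    (hP : ∀ m ≥ 1, ∀ w : Fin m → α, P w ≠ 0 → c / 2 ^ m ≤ P w ∧ P w ≤ C / 2 ^ m)
    (hS : ∀ m ≥ 1, ∀ w : Fin m → α, P w ≠ 0 → w ∈ S m)
    (hsum : ∀ m ≥ 1, ∑ w : Fin m → α, P w = 1)
    (hlow : ∀ m ≥ 1, 2 ^ m ≤ {w : Fin m → α | P w ≠ 0}.ncard)
    (hup : ∀ m ≥ 1, ((S m).ncard : ℝ) ≤ K * 2 ^ m) :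
    Tendsto (fun m : ℕ => renyiBlockEntropy (S m) P β / (m : ℝ)) atTop (𝓝 (Real.log 2)) := by
  rcases eq_or_ne β 1 with rfl | h1
  · exact tendsto_div_natCast_of_abs_sub_le fun m hm =>
      abs_shannonEntropy_sub_le hc (hP m hm) (hS m hm) (hsum m hm)
  · have h1' : 1 - β ≠ 0 := sub_ne_zero.2 h1.symm
    have h := (tendsto_div_natCast_of_abs_sub_le fun m hm =>
      abs_log_sum_rpow_sub_le hc hC hK hβ (hP m hm) (hS m hm) (hlow m hm) (hup m hm)).const_mul
        (1 / (1 - β))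
    rw [← mul_assoc, one_div_mul_cancel h1', one_mul] at h
    refine h.congr fun m => ?_
    rw [renyiBlockEntropy, if_neg h1, mul_div_assoc]

end Entropy

/-- Every family of blocks between the typical and the admissible ones has entropy rates
`log 2`. -/
lemma tendsto_renyiBlockEntropy_of_subset {S : ∀ m, Set (Fin m → QuarterSymbol)}
    (h1 : ∀ m, typicalBlocks m ⊆ S m) (h2 : ∀ m, S m ⊆ mapAdmissibleBlocks m) {β : ℝ}
    (hβ : 0 ≤ β) :
    Tendsto (fun m : ℕ => renyiBlockEntropy (S m) blockProb β / (m : ℝ)) atTop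
      (𝓝 (Real.log 2)) := by
  obtain ⟨c, hc, hP⟩ := blockProb_mem_Icc
  refine tendsto_renyiBlockEntropy_div (C := 2) (K := 3) hc two_pos three_pos hβ hP
    (fun m _ => h1 m) (fun m _ => sum_blockProb m) ?_ ?_
  · rintro (_ | m) hm
    · omega
    have h : {w : Fin (m + 1) → QuarterSymbol | blockProb w ≠ 0}.ncard = 2 ^ (m + 2) :=
      ncard_typicalBlocks m
    rw [h]
    exact Nat.pow_le_pow_right two_pos (by omega)
  · rintro (_ | m) hm
    · omega
    have h3 := Set.ncard_le_ncard (h2 (m + 1)) (Set.toFinite _)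
    have h4 := ncard_mapAdmissibleBlocks_le m
    have h5 : (S (m + 1)).ncard ≤ 3 * 2 ^ (m + 1) := by
      rw [pow_succ]
      omega
    exact_mod_cast h5

/-! ### Typical orbits -/

lemma blockFrequency_eq_birkhoffAverage {x : ℝ} (hx : x ∈ Set.Icc (0 : ℝ) 1) {m : ℕ}
    (w : Fin m → QuarterSymbol) (N : ℕ) :
    blockFrequency (symbolSeq x) w N =
      birkhoffAverage ℝ logisticMap ((cylinder w).indicator 1) N x := by
  classical
  have hmem (n : ℕ) : logisticMap^[n] x ∈ cylinder w ↔ blockAt (symbolSeq x) m n = w := by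
    rw [blockAt_symbolSeq x m n]
    exact and_iff_right (iterate_logisticMap_mem_Icc hx n)
  simp only [blockFrequency, birkhoffAverage, birkhoffSum, Set.indicator_apply, hmem, Pi.one_apply,
    Finset.sum_boole, smul_eq_mul]
  rw [div_eq_inv_mul]

lemma ae_tendsto_blockFrequency : ∀ᵐ x ∂naturalMeasure, ∀ (m : ℕ) (w : Fin m → QuarterSymbol),
    Tendsto (blockFrequency (symbolSeq x) w) atTop (𝓝 (blockProb w)) := by
  refine ae_all_iff.2 fun m => ae_all_iff.2 fun w => ?_
  have hw := measurableSet_cylinder w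
  filter_upwards [ae_mem_Ioo, ae_tendsto_birkhoffAverage ergodic_logisticMap
    (measurable_one.indicator hw) ((integrable_const (1 : ℝ)).indicator hw)] with x hx h
  rw [show ∫ y, (cylinder w).indicator (1 : ℝ → ℝ) y ∂naturalMeasure = blockProb w from
    integral_indicator_one hw] at h
  exact h.congr fun N =>
    (blockFrequency_eq_birkhoffAverage (Set.Ioo_subset_Icc_self hx) w N).symm

/-- Almost every orbit shows exactly the blocks of positive probability: these have a positive
limiting frequency, and the other cylinders are null sets, which almost every orbit avoids. -/
lemma ae_admissibleBlocks_eq : ∀ᵐ x ∂naturalMeasure, ∀ m,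
    admissibleBlocks (symbolSeq x) m = typicalBlocks m := by
  have hnull : ∀ᵐ x ∂naturalMeasure, ∀ (m : ℕ) (w : Fin m → QuarterSymbol) (n : ℕ),
      blockProb w = 0 → logisticMap^[n] x ∉ cylinder w := by
    refine ae_all_iff.2 fun m => ae_all_iff.2 fun w => ae_all_iff.2 fun n => ?_
    by_cases hw : blockProb w = 0
    · have h0 : naturalMeasure (cylinder w) = 0 := (measureReal_eq_zero_iff (by finiteness)).1 hw
      filter_upwards [(ergodic_logisticMap.toMeasurePreserving.iterate n).quasiMeasurePreserving.ae
        (measure_eq_zero_iff_ae_notMem.1 h0)] with x hx _ using hx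
    · exact ae_of_all _ fun x h => absurd h hw
  filter_upwards [ae_mem_Ioo, ae_tendsto_blockFrequency, hnull] with x hx hfreq hx0 m
  ext w
  constructor
  · rintro ⟨n, rfl⟩ h
    exact hx0 m _ n h ⟨iterate_logisticMap_mem_Icc (Set.Ioo_subset_Icc_self hx) n,
      (blockAt_symbolSeq x m n).symm⟩
  · intro hw
    by_contra hadm
    refine hw (tendsto_nhds_unique (hfreq m w) (tendsto_const_nhds.congr fun N => ?_))
    rw [blockFrequency, Finset.filter_false_of_mem fun n _ h => hadm ⟨n, h⟩]
    simp

lemma symbolSeq_succ_ne_D {x : ℝ} {n : ℕ} (h : symbolSeq x n = .A) : symbolSeq x (n + 1) ≠ .D := by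
  have hA : logisticMap^[n] x < 1 / 4 := by
    by_contra hlt
    rw [symbolSeq, quarterSymbol, if_neg hlt] at h
    split_ifs at h
  have hle : logisticMap (logisticMap^[n] x) ≤ 3 / 4 := by
    simp only [logisticMap] at *
    nlinarith
  rw [symbolSeq, Function.iterate_succ_apply', quarterSymbol]
  split_ifs <;> simp

end FourSymbolLogistic

theorem mainTheorem4 :
    -- the measure that gives the block probabilities is an invariant probability measure
    IsProbabilityMeasure FourSymbolLogistic.naturalMeasure ∧
    MeasurePreserving FourSymbolLogistic.logisticMap
      FourSymbolLogistic.naturalMeasure FourSymbolLogistic.naturalMeasure ∧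
    -- entropies of the map with the four-symbol partition
    (∀ β : ℝ, 0 ≤ β →
      Tendsto (fun m : ℕ => FourSymbolLogistic.renyiBlockEntropy
          (FourSymbolLogistic.mapAdmissibleBlocks m) FourSymbolLogistic.blockProb β / (m : ℝ))
        atTop (𝓝 (Real.log 2))) ∧
    -- the symbolic sequence of a typical trajectory
    (∀ᵐ x ∂(volume.restrict (Set.Icc (0 : ℝ) 1)),
      (∀ (m : ℕ) (w : Fin m → FourSymbolLogistic.QuarterSymbol),
        Tendsto (FourSymbolLogistic.blockFrequency (FourSymbolLogistic.symbolSeq x) w)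
          atTop (𝓝 (FourSymbolLogistic.blockProb w))) ∧
      (∀ β : ℝ, 0 ≤ β →
        Tendsto (fun m : ℕ => FourSymbolLogistic.renyiBlockEntropy
            (FourSymbolLogistic.admissibleBlocks (FourSymbolLogistic.symbolSeq x) m)
            FourSymbolLogistic.blockProb β / (m : ℝ))
          atTop (𝓝 (Real.log 2))) ∧
      (∀ m : ℕ, 1 ≤ m →
        (FourSymbolLogistic.admissibleBlocks
          (FourSymbolLogistic.symbolSeq x) m).ncard = 2 ^ (m + 1) ∧
        (FourSymbolLogistic.forbiddenBlocks
          (FourSymbolLogistic.symbolSeq x) m).ncard = 2 ^ m * (2 ^ m - 2))) ∧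
    Real.log 2 < Real.log 4 ∧
    -- the pattern (A, D) is forbidden, for every trajectory
    (![FourSymbolLogistic.QuarterSymbol.A, FourSymbolLogistic.QuarterSymbol.D] ∈
      FourSymbolLogistic.mapForbiddenBlocks 2) ∧
    (∀ x ∈ Set.Icc (0 : ℝ) 1, ∀ n : ℕ,
      FourSymbolLogistic.symbolSeq x n = FourSymbolLogistic.QuarterSymbol.A →
        FourSymbolLogistic.symbolSeq x (n + 1) ≠ FourSymbolLogistic.QuarterSymbol.D) := by
  open FourSymbolLogistic in
  refine ⟨inferInstance, ergodic_logisticMap.toMeasurePreserving, fun β hβ =>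
    tendsto_renyiBlockEntropy_of_subset typicalBlocks_subset_mapAdmissibleBlocks
      (fun m => subset_rfl) hβ, ?_, Real.log_lt_log two_pos (by norm_num), ?_,
    fun x _ n => symbolSeq_succ_ne_D⟩
  · filter_upwards [restrict_Icc_absolutelyContinuous.ae_le ae_tendsto_blockFrequency,
      restrict_Icc_absolutelyContinuous.ae_le ae_admissibleBlocks_eq] with x hfreq hadm
    refine ⟨hfreq, fun β hβ => ?_, ?_⟩
    · simp only [hadm]
      exact tendsto_renyiBlockEntropy_of_subset (fun m => subset_rfl)
        typicalBlocks_subset_mapAdmissibleBlocks hβ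
    · rintro (_ | m) hm
      · omega
      have hcard := ncard_typicalBlocks m
      refine ⟨by rw [hadm, hcard], ?_⟩
      rw [forbiddenBlocks, hadm, Set.ncard_compl, hcard, Nat.card_eq_fintype_card,
        Fintype.card_fun, card_quarterSymbol, Fintype.card_fin, Nat.mul_sub, ← mul_pow, pow_succ]
      rfl
  · intro h
    obtain ⟨x, -, hx⟩ := mem_mapAdmissibleBlocks.1 h
    exact symbolSeq_succ_ne_D (congrFun hx 0) (congrFun hx 1)
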